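/- Let $\mathcal{A}$ be a compact irreducible set of real $2\times 2$ matrices (irreducible: no common invariant subspace except $\{0\}$ and $\mathbb{R}^2$) with $0\notin\mathcal{A}$. A trajectory of $\mathcal{A}$ is a solution of $\dot x(t)=A(t)x(t)$, $t\ge 0$, for a measurable switching law $A(\cdot):[0,\infty)\to\mathcal{A}$. The Lyapunov exponent $\sigma(\mathcal{A})$ is the infimum of the numbers $\sigma$ such that every trajectory satisfies $\|x(t)\|\le C(x)\,e^{\sigma t}$, $t\ge 0$. A norm $f$ on $\mathbb{R}^2$ is a Barabanov norm of $\mathcal{A}$ if $f(x(t))\le e^{\sigma(\mathcal{A}) t}f(x(0))$, $t\ge0$, for every trajectory of $\mathcal{A}$, and for every $x_0\in\mathbb{R}^2$ there is a trajectory $\bar x$ of $\mathrm{co}(\mathcal{A})$ with $\bar x(0)=x_0$ and $f(\bar x(t))=e^{\sigma(\mathcal{A}) t}f(x_0)$ for all $t\ge0$. A point of the unit sphere $S=\{x: f(x)=1\}$ is a corner point if the left and right tangent rays to $S$ at it are not collinear. A matrix $A$ is called degenerate if $\det A=0$ and $A\neq 0$. Suppose $\sigma(\mathcal{A})=0$ and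 let $f$ be a Barabanov norm of $\mathcal{A}$ with unit sphere $S$. Then every closed arc of $S$ connecting two distinct corner points of $S$ contains a point of the kernel of some degenerate matrix $A\in\mathrm{co}(\mathcal{A})$. Consequently, if $f$ is non-smooth, i.e. not differentiable at some nonzero point, then $\mathrm{co}(\mathcal{A})$ contains a degenerate matrix. -/

import Mathlib

namespace PlanarSwitching

/-- The plane. All norms on it are equivalent, so growth rates, continuity and limits of rays
do not depend on the norm that Lean puts on this type. -/
abbrev Plane : Type := Fin 2 → ℝ

/-- Real two by two matrices, acting on the plane by `A *ᵥ x` (`Matrix.mulVec`). -/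
abbrev Mat : Type := Matrix (Fin 2) (Fin 2) ℝ

/-- `x`, restricted to `[0, ∞)`, is a trajectory of the linear switching system with control
set `K`: for some measurable switching law `A : [0, ∞) → K`, the function `x` is a Carathéodory
solution of `x' = A(t) x`, that is, a solution of the integral equation. -/
def IsTrajectory (K : Set Mat) (x : ℝ → Plane) : Prop :=
  ∃ A : ℝ → Mat, (∀ i j, Measurable fun t => A t i j) ∧ (∀ t, 0 ≤ t → A t ∈ K) ∧
    ContinuousOn x (Set.Ici 0) ∧
    ∀ t, 0 ≤ t →
      IntervalIntegrable (fun s => (A s).mulVec (x s)) MeasureTheory.volume 0 t ∧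
      x t = x 0 + ∫ s in (0 : ℝ)..t, (A s).mulVec (x s)

/-- The Lyapunov exponent of a control set: the infimum of the numbers `σ` such that every
trajectory is `O(exp (σ t))` on `[0, ∞)`, with a constant that may depend on the trajectory. -/
noncomputable def lyapunovExponent (K : Set Mat) : ℝ :=
  sInf {σ : ℝ | ∀ x : ℝ → Plane, IsTrajectory K x →
    ∃ C : ℝ, ∀ t, 0 ≤ t → ‖x t‖ ≤ C * Real.exp (σ * t)}

/-- The matrices of `K` have no common invariant subspace other than `0` and the plane. -/
def IsIrreducible (K : Set Mat) : Prop :=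
  ∀ W : Submodule ℝ Plane, (∀ A ∈ K, ∀ x ∈ W, A.mulVec x ∈ W) → W = ⊥ ∨ W = ⊤

/-- `f` is a Barabanov (invariant) norm of `K`: it is a norm, along every trajectory of `K` it
grows at most like `exp (σ t)`, `σ` being the Lyapunov exponent, and every point is the start of
an extremal trajectory, with switching law in the convex hull of `K`, along which
it grows exactly like `exp (σ t)`. -/
structure IsBarabanovNorm (K : Set Mat) (f : Seminorm ℝ Plane) : Prop where
  eq_zero_of_map_eq_zero : ∀ x, f x = 0 → x = 0
  le_of_trajectory : ∀ x : ℝ → Plane, IsTrajectory K x →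
    ∀ t, 0 ≤ t → f (x t) ≤ Real.exp (lyapunovExponent K * t) * f (x 0)
  exists_extremal : ∀ x₀ : Plane, ∃ x : ℝ → Plane, IsTrajectory (convexHull ℝ K) x ∧ x 0 = x₀ ∧
    ∀ t, 0 ≤ t → f (x t) = Real.exp (lyapunovExponent K * t) * f x₀

/-- The unit sphere, that is, the boundary of the unit ball `{x | f x ≤ 1}`. -/
def unitSphere (f : Seminorm ℝ Plane) : Set Plane := {x | f x = 1}

/-- The determinant of the pair `x, y`: positive if and only if the rotation by less than `π`
that takes the direction of `x` to that of `y` is counterclockwise. -/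
def cross (x y : Plane) : ℝ := x 0 * y 1 - x 1 * y 0

/-- The vector `u` is the direction of the left tangent ray to the curve `S` at `x`: the
limit of the rays from `x` through `y`, as `y` tends to `x` along `S` with the
short arc from `x` to `y` directed counterclockwise. -/
def IsLeftTangent (S : Set Plane) (x u : Plane) : Prop :=
  Filter.Tendsto (fun y => ‖y - x‖⁻¹ • (y - x)) (nhdsWithin x (S ∩ {y | 0 < cross x y})) (nhds u)

/-- The direction of the right tangent ray: the same, with the arc directed clockwise. -/
def IsRightTangent (S : Set Plane) (x v : Plane) : Prop :=
  Filter.Tendsto (fun y => ‖y - x‖⁻¹ • (y - x)) (nhdsWithin x (S ∩ {y | cross x y < 0})) (nhds v)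

/-- A corner point of `S`: the left and the right tangent rays are not collinear. -/
def IsCornerPoint (S : Set Plane) (x : Plane) : Prop :=
  x ∈ S ∧ ∃ u v : Plane, IsLeftTangent S x u ∧ IsRightTangent S x v ∧
    LinearIndependent ℝ ![u, v]

/-- The unit vector with argument `θ`. -/
noncomputable def dir (θ : ℝ) : Plane := ![Real.cos θ, Real.sin θ]

/-- The closed arc of `S` that goes counterclockwise from `x₁` to `x₂`, where `S` is a curve
that meets each ray from the origin once, away from the origin. For two distinct points of `S`,
the two arcs of `S` that connect them are `arc S x₁ x₂` and `arc S x₂ x₁`. -/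
def arc (S : Set Plane) (x₁ x₂ : Plane) : Set Plane :=
  {y | y ∈ S ∧ ∃ a s t : ℝ, 0 ≤ s ∧ s ≤ t ∧ t < 2 * Real.pi ∧
    SameRay ℝ (dir a) x₁ ∧ SameRay ℝ (dir (a + s)) y ∧ SameRay ℝ (dir (a + t)) x₂}

/-- Degenerate matrices. The zero matrix is not counted. -/
def IsDegenerate (A : Mat) : Prop := A.det = 0 ∧ A ≠ 0

end PlanarSwitching

namespace PlanarSwitching

open Set Filter Topology MeasureTheory

/-! ### Compactness of convex hulls -/

section ConvexHull

/-- In a finite-dimensional space the convex hull of a compact set is compact. -/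
theorem isCompact_convexHull_of_finiteDimensional {E : Type*} [AddCommGroup E] [Module ℝ E]
    [TopologicalSpace E] [IsTopologicalAddGroup E] [ContinuousSMul ℝ E] [FiniteDimensional ℝ E]
    {K : Set E} (hK : IsCompact K) : IsCompact (convexHull ℝ K) := by
  -- By Carathéodory, at most `finrank + 1` points are needed; the range bound is exclusive, hence
  -- `+ 2`.
  have key : convexHull ℝ K = ⋃ n ∈ Finset.range (Module.finrank ℝ E + 2),
      (fun p : (Fin n → ℝ) × (Fin n → E) => ∑ i, p.1 i • p.2 i) ''
        (stdSimplex ℝ (Fin n) ×ˢ Set.univ.pi fun _ => K) := by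
    apply Subset.antisymm
    · intro x hx
      obtain ⟨ι, _, z, w, hz, hind, hw, hw1, rfl⟩ := eq_pos_convex_span_of_mem_convexHull hx
      have hcard : Fintype.card ι < Module.finrank ℝ E + 2 := by
        have h1 := hind.card_le_finrank_succ
        have h2 := Submodule.finrank_le (vectorSpan ℝ (Set.range z))
        omega
      refine mem_biUnion (by simpa using hcard) ?_
      let e := (Fintype.equivFin ι).symm
      refine ⟨(w ∘ e, z ∘ e), ⟨⟨fun i => (hw _).le, ?_⟩, fun i _ => hz ⟨_, rfl⟩⟩, ?_⟩
      · simpa using (Equiv.sum_comp e w).trans hw1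
      · exact Equiv.sum_comp e fun i => w i • z i
    · refine iUnion₂_subset fun n _ => ?_
      rintro _ ⟨⟨w, z⟩, ⟨hw, hz⟩, rfl⟩
      exact (convex_convexHull ℝ K).sum_mem (fun i _ => hw.1 i) hw.2
        fun i _ => subset_convexHull ℝ K (hz i (mem_univ i))
  rw [key]
  refine (Finset.range _).isCompact_biUnion fun n _ => ?_
  refine ((isCompact_stdSimplex ℝ (Fin n)).prod (isCompact_univ_pi fun _ => hK)).image ?_
  fun_prop

end ConvexHull

/-! ### One-sided directional derivatives of a seminorm -/

section DirectionalDerivative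

variable (f : Seminorm ℝ Plane)

theorem seminorm_continuous : Continuous fun x => f x :=
  continuousOn_univ.1 (f.convexOn.continuousOn isOpen_univ)

/-- The one-sided directional derivative of `f` at `z` along `v`, as the infimum of the
difference quotients. -/
noncomputable def dirDeriv (z v : Plane) : ℝ :=
  ⨅ h : Set.Ioi (0 : ℝ), (f (z + h.1 • v) - f z) / h.1

variable {f}

theorem neg_le_quotient (z v : Plane) {h : ℝ} (hh : 0 < h) :
    -f v ≤ (f (z + h • v) - f z) / h := by
  rw [le_div_iff₀ hh]
  have h1 := map_add_le_add f (z + h • v) (-(h • v))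
  rw [map_neg_eq_map, map_smul_eq_mul, Real.norm_of_nonneg hh.le, add_neg_cancel_right] at h1
  linarith

theorem bddBelow_quotient (z v : Plane) :
    BddBelow (Set.range fun h : Set.Ioi (0 : ℝ) => (f (z + h.1 • v) - f z) / h.1) :=
  ⟨-f v, by rintro _ ⟨h, rfl⟩; exact neg_le_quotient z v h.2⟩

theorem dirDeriv_le_quotient (z v : Plane) {h : ℝ} (hh : 0 < h) :
    dirDeriv f z v ≤ (f (z + h • v) - f z) / h :=
  ciInf_le (bddBelow_quotient z v) ⟨h, hh⟩

theorem le_dirDeriv {z v : Plane} {c : ℝ}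
    (hc : ∀ h : ℝ, 0 < h → c ≤ (f (z + h • v) - f z) / h) : c ≤ dirDeriv f z v :=
  have : Nonempty (Set.Ioi (0 : ℝ)) := ⟨⟨1, mem_Ioi.2 one_pos⟩⟩
  le_ciInf fun h => hc h.1 h.2

/-- Convexity makes the quotients monotone in the step, so the infimum in `dirDeriv` is the limit as
the step tends to 0. -/
theorem quotient_mono (z v : Plane) {s h : ℝ} (hs : 0 < s) (hsh : s ≤ h) :
    (f (z + s • v) - f z) / s ≤ (f (z + h • v) - f z) / h := by
  have hh : 0 < h := hs.trans_le hsh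
  have h1 : z + s • v = (1 - s / h) • z + (s / h) • (z + h • v) := by
    rw [smul_add, smul_smul, div_mul_cancel₀ _ hh.ne', ← add_assoc, ← add_smul]
    simp
  have h2 := f.convexOn.2 (mem_univ z) (mem_univ (z + h • v))
    (sub_nonneg.2 ((div_le_one hh).2 hsh)) (div_nonneg hs.le hh.le) (sub_add_cancel 1 (s / h))
  rw [← h1, smul_eq_mul, smul_eq_mul] at h2
  rw [div_le_iff₀ hs]
  calc f (z + s • v) - f z ≤ (s / h) * (f (z + h • v) - f z) := by linarith
    _ = _ := by ring

theorem exists_quotient_lt (z v : Plane) {c : ℝ} (hc : dirDeriv f z v < c) :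
    ∃ δ > 0, ∀ s, 0 < s → s ≤ δ → (f (z + s • v) - f z) / s < c := by
  have : Nonempty (Set.Ioi (0 : ℝ)) := ⟨⟨1, mem_Ioi.2 one_pos⟩⟩
  obtain ⟨h, hh⟩ := exists_lt_of_ciInf_lt hc
  exact ⟨h.1, h.2, fun s hs hsh => (quotient_mono z v hs hsh).trans_lt hh⟩

theorem dirDeriv_le_map (z v : Plane) : dirDeriv f z v ≤ f v := by
  refine (dirDeriv_le_quotient z v one_pos).trans ?_
  have := map_add_le_add f z v
  simp only [one_smul, div_one]
  linarith

theorem dirDeriv_add_le (z v w : Plane) :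
    dirDeriv f z (v + w) ≤ dirDeriv f z v + dirDeriv f z w := by
  refine le_of_forall_pos_le_add fun ε hε => ?_
  obtain ⟨δ₁, h₁, H₁⟩ := exists_quotient_lt (f := f) z v (lt_add_of_pos_right _ (half_pos hε))
  obtain ⟨δ₂, h₂, H₂⟩ := exists_quotient_lt (f := f) z w (lt_add_of_pos_right _ (half_pos hε))
  set s := min δ₁ δ₂ with hs
  have hs0 : 0 < s := lt_min h₁ h₂
  have hv := H₁ s hs0 (min_le_left _ _)
  have hw := H₂ s hs0 (min_le_right _ _)
  have h1 : z + (s / 2) • (v + w) = (1 / 2 : ℝ) • (z + s • v) + (1 / 2 : ℝ) • (z + s • w) := by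
    ext i; simp; ring
  have h2 := f.convexOn.2 (mem_univ (z + s • v)) (mem_univ (z + s • w))
    (by norm_num : (0 : ℝ) ≤ 1 / 2) (by norm_num : (0 : ℝ) ≤ 1 / 2) (by norm_num)
  rw [← h1, smul_eq_mul, smul_eq_mul] at h2
  have h3 := dirDeriv_le_quotient (f := f) z (v + w) (half_pos hs0)
  rw [div_lt_iff₀ hs0] at hv hw
  rw [le_div_iff₀ (half_pos hs0)] at h3
  nlinarith

theorem dirDeriv_smul_le {z v : Plane} {c : ℝ} (hc : 0 < c) :
    dirDeriv f z (c • v) ≤ c * dirDeriv f z v := by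
  have : c⁻¹ * dirDeriv f z (c • v) ≤ dirDeriv f z v := le_dirDeriv fun h hh => by
    have h1 := dirDeriv_le_quotient (f := f) z (c • v) (div_pos hh hc)
    rw [smul_smul, div_mul_cancel₀ _ hc.ne'] at h1
    calc c⁻¹ * dirDeriv f z (c • v) ≤ c⁻¹ * ((f (z + h • v) - f z) / (h / c)) := by gcongr
      _ = _ := by field_simp
  rwa [inv_mul_le_iff₀ hc] at this

theorem dirDeriv_zero_right (z : Plane) : dirDeriv f z 0 = 0 := by
  refine le_antisymm (by simpa using dirDeriv_le_map (f := f) z 0) (le_dirDeriv fun h _ => ?_)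
  simp

theorem dirDeriv_smul_nonpos {z v : Plane} {c : ℝ} (hc : 0 ≤ c) (hv : dirDeriv f z v ≤ 0) :
    dirDeriv f z (c • v) ≤ 0 := by
  rcases hc.eq_or_lt with rfl | hc
  · simp [dirDeriv_zero_right]
  · exact (dirDeriv_smul_le hc).trans (mul_nonpos_of_nonneg_of_nonpos hc.le hv)

theorem dirDeriv_smul_left {z v : Plane} {c : ℝ} (hc : 0 < c) :
    dirDeriv f (c • z) v = dirDeriv f z v := by
  have key : ∀ (z : Plane) {c : ℝ}, 0 < c → dirDeriv f z v ≤ dirDeriv f (c • z) v := by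
    refine fun z c hc => le_dirDeriv fun h hh => ?_
    have h1 := dirDeriv_le_quotient (f := f) z v (div_pos hh hc)
    have h2 : c • z + h • v = c • (z + (h / c) • v) := by
      rw [smul_add, smul_smul, mul_div_cancel₀ _ hc.ne']
    rw [h2, map_smul_eq_mul, map_smul_eq_mul, Real.norm_of_nonneg hc.le]
    refine h1.trans (le_of_eq ?_)
    field_simp
  refine le_antisymm ?_ (key z hc)
  simpa [smul_smul, hc.ne'] using key (c • z) (inv_pos.2 hc)

theorem dirDeriv_neg_left (z v : Plane) : dirDeriv f (-z) v = dirDeriv f z (-v) := by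
  unfold dirDeriv
  congr 1
  ext h
  rw [map_neg_eq_map, ← map_neg_eq_map f (-z + h.1 • v)]
  congr 3
  rw [neg_add, neg_neg, smul_neg]

theorem dirDeriv_nonneg_iff {z v : Plane} :
    0 ≤ dirDeriv f z v ↔ ∀ h : ℝ, 0 < h → f z ≤ f (z + h • v) := by
  constructor
  · intro H h hh
    have := H.trans (dirDeriv_le_quotient z v hh)
    rw [le_div_iff₀ hh] at this
    linarith
  · exact fun H => le_dirDeriv fun h hh => div_nonneg (sub_nonneg.2 (H h hh)) hh.le

theorem dirDeriv_smul_self (z : Plane) (c : ℝ) : dirDeriv f z (c • z) = c * f z := by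
  apply le_antisymm
  · have hs : (0 : ℝ) < 1 / (|c| + 1) := by positivity
    refine (dirDeriv_le_quotient z _ hs).trans (le_of_eq ?_)
    set s := 1 / (|c| + 1)
    have h1 : 0 ≤ 1 + s * c := by
      have : s * (|c| + 1) = 1 := one_div_mul_cancel (by positivity)
      nlinarith [neg_abs_le c]
    rw [smul_smul, show z + (s * c) • z = (1 + s * c) • z by rw [add_smul, one_smul],
      map_smul_eq_mul, Real.norm_of_nonneg h1]
    field_simp
    ring
  · refine le_dirDeriv fun h hh => ?_
    rw [smul_smul, show z + (h * c) • z = (1 + h * c) • z by rw [add_smul, one_smul],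
      map_smul_eq_mul, le_div_iff₀ hh, Real.norm_eq_abs]
    nlinarith [le_abs_self (1 + h * c), apply_nonneg f z]

theorem dirDeriv_nonpos_of_tendsto {z v : Plane} {w : ℕ → Plane}
    (hw : Tendsto w atTop (𝓝 v)) (h : ∀ᶠ n in atTop, dirDeriv f z (w n) ≤ 0) :
    dirDeriv f z v ≤ 0 := by
  have h1 : Tendsto (fun n => f (v - w n)) atTop (𝓝 0) := by
    have := ((seminorm_continuous f).tendsto (v - v)).comp (tendsto_const_nhds.sub hw)
    simpa [Function.comp_def] using this
  refine ge_of_tendsto h1 (h.mono fun n hn => ?_)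
  have := dirDeriv_add_le (f := f) z (w n) (v - w n)
  rw [add_sub_cancel] at this
  linarith [dirDeriv_le_map (f := f) z (v - w n)]

/-- The base point may vary as well: by `dirDeriv_nonneg_iff` the condition is a family of
inequalities between values of the continuous function `f`, hence closed. -/
theorem dirDeriv_nonneg_of_tendsto {z v : Plane} {y w : ℕ → Plane}
    (hy : Tendsto y atTop (𝓝 z)) (hw : Tendsto w atTop (𝓝 v))
    (h : ∀ᶠ n in atTop, 0 ≤ dirDeriv f (y n) (w n)) : 0 ≤ dirDeriv f z v := by
  rw [dirDeriv_nonneg_iff]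
  intro s hs
  refine le_of_tendsto_of_tendsto (((seminorm_continuous f).tendsto _).comp hy)
    (((seminorm_continuous f).tendsto _).comp (hy.add (hw.const_smul s))) (h.mono fun n hn => ?_)
  exact dirDeriv_nonneg_iff.1 hn s hs

/-- Going from `y` along `v` to the ray of `z` does not lower `f`. Traversed backwards and rescaled
by `l⁻¹`, the same segment starts at `z` and does not raise `f` at its end. -/
theorem dirDeriv_neg_nonpos_of_add_smul_eq {y z v : Plane} {h l : ℝ} (hh : 0 < h) (hl : 0 < l)
    (hy : y + h • v = l • z) (hD : 0 ≤ dirDeriv f y v) : dirDeriv f z (-v) ≤ 0 := by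
  have h1 := dirDeriv_nonneg_iff.1 hD h hh
  refine (dirDeriv_le_quotient z (-v) (div_pos hh hl)).trans
    (div_nonpos_of_nonpos_of_nonneg ?_ (div_pos hh hl).le)
  have h2 : z + (h / l) • -v = l⁻¹ • y := by
    rw [eq_sub_of_add_eq hy, smul_sub, smul_smul, smul_smul, inv_mul_cancel₀ hl.ne', one_smul,
      smul_neg, ← sub_eq_add_neg, div_eq_inv_mul]
  rw [hy, map_smul_eq_mul, Real.norm_of_nonneg hl.le] at h1
  rw [h2, map_smul_eq_mul, Real.norm_of_nonneg (inv_pos.2 hl).le, sub_nonpos,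
    inv_mul_le_iff₀ hl]
  exact h1

theorem convex_dirDeriv_mulVec_nonpos (z : Plane) :
    Convex ℝ {A : Mat | dirDeriv f z (A.mulVec z) ≤ 0} := by
  intro A hA B hB a b ha hb _
  rw [mem_ofPred_eq, Matrix.add_mulVec, Matrix.smul_mulVec, Matrix.smul_mulVec]
  exact (dirDeriv_add_le _ _ _).trans
    (add_nonpos (dirDeriv_smul_nonpos ha hA) (dirDeriv_smul_nonpos hb hB))

theorem dirDeriv_eq_zero {z v : Plane} (h₁ : dirDeriv f z v ≤ 0) (h₂ : dirDeriv f z (-v) ≤ 0) :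
    dirDeriv f z v = 0 := by
  have := dirDeriv_add_le (f := f) z v (-v)
  rw [add_neg_cancel, dirDeriv_zero_right] at this
  linarith

end DirectionalDerivative

/-! ### Corners of the unit sphere -/

section Corner

variable {f : Seminorm ℝ Plane}

theorem exists_eq_smul_of_cross_eq_zero {z w : Plane} (hz : z ≠ 0) (h : cross z w = 0) :
    ∃ c : ℝ, w = c • z := by
  unfold cross at h
  have hne : z 0 ≠ 0 ∨ z 1 ≠ 0 := by
    by_contra! hc
    exact hz (funext fun i => by fin_cases i <;> simp [hc.1, hc.2])
  rcases hne with h0 | h0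
  · refine ⟨w 0 / z 0, funext fun i => ?_⟩
    fin_cases i <;> simp <;> field_simp
    linarith
  · refine ⟨w 1 / z 1, funext fun i => ?_⟩
    fin_cases i <;> simp <;> field_simp
    linarith

theorem cross_add_smul_right (z w : Plane) (a b : ℝ) :
    cross z (a • z + b • w) = b * cross z w := by
  simp [cross]; ring

theorem cross_neg_right (z w : Plane) : cross z (-w) = -cross z w := by
  simp [cross]; ring

theorem continuous_cross : Continuous fun p : Plane × Plane => cross p.1 p.2 := by
  unfold cross; fun_prop

variable (f) in
/-- The directional derivative of `f` at `z` vanishes on no line transversal to `z`. -/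
def HasCorner (z : Plane) : Prop :=
  ∀ w, cross z w ≠ 0 → dirDeriv f z w ≤ 0 → 0 < dirDeriv f z (-w)

theorem HasCorner.of_smul {z : Plane} {c : ℝ} (hc : 0 < c) (h : HasCorner f (c • z)) :
    HasCorner f z := by
  intro w hw hD
  have := h w (by simp only [cross, Pi.smul_apply, smul_eq_mul] at hw ⊢
                  rw [mul_assoc, mul_assoc, ← mul_sub]; exact mul_ne_zero hc.ne' hw)
  rw [dirDeriv_smul_left hc, dirDeriv_smul_left hc] at this
  exact this hD

theorem HasCorner.neg {z : Plane} (h : HasCorner f z) : HasCorner f (-z) := by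
  intro w hw hD
  rw [dirDeriv_neg_left] at hD ⊢
  refine h (-w) ?_ hD
  contrapose! hw
  simp only [cross, Pi.neg_apply] at hw ⊢
  linarith

/-- Chords from `z` to the normalizations of `z + s w`, suitably scaled, converge to a direction
`w` along which `f` is stationary. -/
theorem tendsto_chord {z w : Plane} (hz : f z = 1) (h₁ : dirDeriv f z w ≤ 0)
    (h₂ : dirDeriv f z (-w) ≤ 0) :
    Tendsto (fun s : ℝ => (s⁻¹ * (f (z + s • w))) • ((f (z + s • w))⁻¹ • (z + s • w) - z))
      (𝓝[>] 0) (𝓝 w) := by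
  have h0 : 0 ≤ dirDeriv f z w := (dirDeriv_eq_zero h₁ h₂).ge
  have hq : Tendsto (fun s : ℝ => (f (z + s • w) - f z) / s) (𝓝[>] 0) (𝓝 0) := by
    refine tendsto_order.2 ⟨fun c hc => ?_, fun c hc => ?_⟩
    · filter_upwards [self_mem_nhdsWithin] with s hs
      exact hc.trans_le (h0.trans (dirDeriv_le_quotient z w hs))
    · obtain ⟨δ, hδ, H⟩ := exists_quotient_lt z w (h₁.trans_lt hc)
      filter_upwards [Ioc_mem_nhdsGT hδ] with s hs using H s hs.1 hs.2
  have h3 : Tendsto (fun s : ℝ => w - ((f (z + s • w) - f z) / s) • z) (𝓝[>] 0) (𝓝 w) := by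
    simpa using tendsto_const_nhds.sub (hq.smul_const z)
  refine h3.congr' ?_
  filter_upwards [self_mem_nhdsWithin] with s hs
  have hs' : s ≠ 0 := ne_of_gt hs
  have hf : f (z + s • w) ≠ 0 := by
    intro h
    have h1 := dirDeriv_le_quotient (f := f) z w hs
    rw [h, hz] at h1
    have : (0 - 1) / s < 0 := div_neg_of_neg_of_pos (by norm_num) hs
    linarith
  ext i
  simp [hz]
  field_simp
  ring

/-- If `f` is stationary at `z` along `w`, then the tangent ray on the side of `w` is along `w`. -/
theorem eq_of_tendsto_chord {z w u : Plane} (hz : f z = 1) (hw : cross z w ≠ 0)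
    (h₁ : dirDeriv f z w ≤ 0) (h₂ : dirDeriv f z (-w) ≤ 0) {T : Set Plane}
    (hT : ∀ s : ℝ, 0 < s → ∀ c : ℝ, 0 < c → c • (z + s • w) ∈ T)
    (hu : Tendsto (fun y => ‖y - z‖⁻¹ • (y - z)) (𝓝[unitSphere f ∩ T] z) (𝓝 u)) :
    u = ‖w‖⁻¹ • w := by
  have hw0 : w ≠ 0 := by rintro rfl; simp [cross] at hw
  have hline : Tendsto (fun s : ℝ => z + s • w) (𝓝[>] 0) (𝓝 z) := by
    have : Continuous fun s : ℝ => z + s • w := by fun_prop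
    simpa using (this.tendsto 0).mono_left nhdsWithin_le_nhds
  have hfl : Tendsto (fun s : ℝ => f (z + s • w)) (𝓝[>] 0) (𝓝 1) :=
    hz ▸ ((seminorm_continuous f).tendsto z).comp hline
  have hpos : ∀ᶠ s : ℝ in 𝓝[>] 0, 0 < f (z + s • w) := hfl.eventually_const_lt one_pos
  let y : ℝ → Plane := fun s => (f (z + s • w))⁻¹ • (z + s • w)
  have hy : Tendsto y (𝓝[>] 0) (𝓝[unitSphere f ∩ T] z) := by
    refine tendsto_nhdsWithin_iff.2 ⟨?_, ?_⟩
    · simpa only [inv_one, one_smul] using (hfl.inv₀ one_ne_zero).smul hline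
    filter_upwards [hpos, self_mem_nhdsWithin] with s hs hs0
    refine ⟨?_, hT s hs0 _ (inv_pos.2 hs)⟩
    change f _ = 1
    rw [map_smul_eq_mul, Real.norm_of_nonneg (inv_pos.2 hs).le, inv_mul_cancel₀ hs.ne']
  have hc := tendsto_chord hz h₁ h₂
  have hn := (hc.norm.inv₀ (norm_ne_zero_iff.2 hw0)).smul hc
  refine tendsto_nhds_unique ((hu.comp hy).congr' ?_) hn
  filter_upwards [hpos, self_mem_nhdsWithin] with s hs hs0
  have hs0 : 0 < s := hs0
  have hk : 0 < s⁻¹ * f (z + s • w) := by positivity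
  simp only [Function.comp_apply, y]
  rw [norm_smul, Real.norm_of_nonneg hk.le, smul_smul, mul_inv, mul_comm, ← mul_assoc,
    mul_inv_cancel₀ hk.ne', one_mul]

/-- If `f` were stationary at `z` along both `w` and `-w`, the two tangent rays would have the
opposite directions of `w` and `-w`. -/
theorem IsCornerPoint.hasCorner {z : Plane} (h : IsCornerPoint (unitSphere f) z) :
    HasCorner f z := by
  obtain ⟨hz, u, v, hu, hv, huv⟩ := h
  have key : ∀ w, 0 < cross z w → dirDeriv f z w ≤ 0 → 0 < dirDeriv f z (-w) := by
    intro w hw h1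
    by_contra! h2
    have e1 := eq_of_tendsto_chord (T := {y | 0 < cross z y}) hz hw.ne' h1 h2
      (fun s hs c hc => by
        have := cross_add_smul_right z w c (c * s)
        rw [mul_smul, ← smul_add] at this
        change 0 < cross _ _
        rw [this]; positivity) hu
    have e2 := eq_of_tendsto_chord (w := -w) (T := {y | cross z y < 0}) hz
      (by rw [cross_neg_right]; exact neg_ne_zero.2 hw.ne') h2 (by rwa [neg_neg])
      (fun s hs c hc => by
        have := cross_add_smul_right z (-w) c (c * s)
        rw [mul_smul, ← smul_add, cross_neg_right] at this
        change cross _ _ < 0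
        rw [this, mul_neg, neg_lt_zero]; positivity) hv
    rw [LinearIndependent.pair_iff] at huv
    have := huv 1 1 (by rw [e1, e2]; simp)
    simp at this
  intro w hw h1
  rcases lt_or_gt_of_ne hw with hw | hw
  · by_contra! h2
    have := key (-w) (by rw [cross_neg_right]; linarith) h2
    rw [neg_neg] at this
    linarith
  · exact key w hw h1

/-- Stationarity along one transversal line gives differentiability on that line, and homogeneity
spreads it to a neighbourhood of `z`. -/
theorem hasCorner_of_not_differentiableAt {z : Plane}
    (h : ¬ DifferentiableAt ℝ (fun y => f y) z) : HasCorner f z := by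
  intro w hw h1
  by_contra! h2
  refine h ?_
  have h0 : dirDeriv f z w = 0 ∧ dirDeriv f z (-w) = 0 :=
    ⟨dirDeriv_eq_zero h1 h2, dirDeriv_eq_zero h2 (by rwa [neg_neg])⟩
  have hq : ∀ v, dirDeriv f z v = 0 → ∀ ε > 0, ∃ δ > 0, ∀ s, 0 < s → s < δ →
      |f (z + s • v) - f z| ≤ ε * s := by
    intro v hv ε hε
    obtain ⟨δ, hδ, H⟩ := exists_quotient_lt (f := f) z v (hv.trans_lt hε)
    refine ⟨δ, hδ, fun s hs hsδ => ?_⟩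
    have h3 := (H s hs hsδ.le).le
    have h4 := hv.ge.trans (dirDeriv_le_quotient z v hs)
    rw [div_le_iff₀ hs] at h3
    rw [le_div_iff₀ hs, zero_mul] at h4
    rwa [abs_of_nonneg h4]
  -- the restriction to the line through `z` along `w` is differentiable
  have hφ : HasDerivAt (fun s : ℝ => f (z + s • w)) 0 0 := by
    rw [hasDerivAt_iff_isLittleO_nhds_zero, Asymptotics.isLittleO_iff]
    intro ε hε
    obtain ⟨δ₁, hδ₁, H₁⟩ := hq w h0.1 ε hε
    obtain ⟨δ₂, hδ₂, H₂⟩ := hq (-w) h0.2 ε hε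
    filter_upwards [Metric.ball_mem_nhds (0 : ℝ) (lt_min hδ₁ hδ₂)] with s hs
    rw [Metric.mem_ball, dist_zero_right, Real.norm_eq_abs, lt_min_iff] at hs
    simp only [zero_add, zero_smul, add_zero, smul_zero, sub_zero, Real.norm_eq_abs]
    rcases lt_trichotomy s 0 with hs0 | rfl | hs0
    · rw [abs_of_neg hs0] at hs ⊢
      have := H₂ (-s) (by linarith) hs.2
      rwa [neg_smul_neg] at this
    · simp
    · rw [abs_of_pos hs0] at hs ⊢
      exact H₁ s hs0 hs.1
  -- in the coordinates `y = a z + b w`, the value is `a f (z + (b / a) w)` near `z`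
  let a : Plane → ℝ := fun y => (y 0 * w 1 - y 1 * w 0) / cross z w
  let b : Plane → ℝ := fun y => (z 0 * y 1 - z 1 * y 0) / cross z w
  have ha : DifferentiableAt ℝ a z := by
    simp only [a]; fun_prop
  have hb : DifferentiableAt ℝ b z := by
    simp only [b]; fun_prop
  have ha1 : a z = 1 := div_self hw
  have hb0 : b z = 0 := by simp only [b]; rw [mul_comm, sub_self, zero_div]
  have hba : DifferentiableAt ℝ (fun y => b y / a y) z := by
    simp only [div_eq_mul_inv]
    exact hb.fun_mul (ha.fun_inv (by rw [ha1]; exact one_ne_zero))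
  have hcomp : DifferentiableAt ℝ (fun y => a y * f (z + (b y / a y) • w)) z := by
    refine ha.mul ?_
    have hφ' : DifferentiableAt ℝ (fun s : ℝ => f (z + s • w)) (b z / a z) := by
      rw [hb0, zero_div]; exact hφ.differentiableAt
    exact hφ'.comp (g := fun s : ℝ => f (z + s • w)) z hba
  refine hcomp.congr_of_eventuallyEq ?_
  have hev : ∀ᶠ y in 𝓝 z, 0 < a y := ha.continuousAt.eventually_const_lt (by simp [ha1])
  filter_upwards [hev] with y hy
  have hy2 : y = a y • (z + (b y / a y) • w) := by
    rw [smul_add, smul_smul, mul_div_cancel₀ _ hy.ne']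
    ext i
    fin_cases i <;> simp [a, b] <;> field_simp <;> simp only [cross] <;> ring
  conv_lhs => rw [hy2]
  rw [map_smul_eq_mul, Real.norm_of_nonneg hy.le]

theorem eq_zero_of_cross_eq_zero {z v : Plane} (hz : 0 < f z) (hc : cross z v = 0)
    (hD : dirDeriv f z v = 0) : v = 0 := by
  have hz0 : z ≠ 0 := by rintro rfl; simp at hz
  obtain ⟨c, rfl⟩ := exists_eq_smul_of_cross_eq_zero hz0 hc
  rw [dirDeriv_smul_self] at hD
  rw [(mul_eq_zero.1 hD).resolve_right hz.ne', zero_smul]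

/-- If `0` is a convex combination of matrices of `K`, then one of these kills a corner. -/
theorem HasCorner.exists_mulVec_eq_zero {z : Plane} (h : HasCorner f z) (hz : 0 < f z)
    {K : Set Mat} (hK : ∀ A ∈ K, dirDeriv f z (A.mulVec z) ≤ 0)
    (h0 : (0 : Mat) ∈ convexHull ℝ K) : ∃ A ∈ K, A.mulVec z = 0 := by
  by_contra! hne
  -- `P` is convex and omits 0, and it contains `K` as long as no matrix of `K` kills `z`.
  let P : Set Mat := {A | dirDeriv f z (A.mulVec z) ≤ 0 ∧ 0 < dirDeriv f z (-A.mulVec z)}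
  have hKP : K ⊆ P := by
    refine fun A hA => ⟨hK A hA, ?_⟩
    by_cases hc : cross z (A.mulVec z) = 0
    · by_contra! hD
      exact hne A hA (eq_zero_of_cross_eq_zero hz hc (dirDeriv_eq_zero (hK A hA) hD))
    · exact h _ hc (hK A hA)
  have hP : Convex ℝ P := by
    have aux : ∀ v w, dirDeriv f z w ≤ 0 → 0 < dirDeriv f z (-v) →
        0 < dirDeriv f z (-(v + w)) := by
      intro v w hw hv
      have := dirDeriv_add_le (f := f) z (-(v + w)) w
      rw [neg_add, neg_add_cancel_right, ← neg_add] at this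
      linarith
    have aux2 : ∀ (v : Plane) (c : ℝ), 0 < c → 0 < dirDeriv f z (-v) →
        0 < dirDeriv f z (-(c • v)) := by
      intro v c hc hv
      by_contra! hcon
      have := dirDeriv_smul_nonpos (inv_pos.2 hc).le hcon
      rw [smul_neg, smul_smul, inv_mul_cancel₀ hc.ne', one_smul] at this
      linarith
    refine convex_iff_forall_pos.2 fun A hA B hB a b ha hb hab => ⟨?_, ?_⟩
    · exact convex_dirDeriv_mulVec_nonpos z hA.1 hB.1 ha.le hb.le hab
    · rw [Matrix.add_mulVec, Matrix.smul_mulVec, Matrix.smul_mulVec]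
      exact aux _ _ (dirDeriv_smul_nonpos hb.le hB.1) (aux2 _ _ ha hA.2)
  have := (convexHull_min hKP hP h0).2
  rw [Matrix.zero_mulVec, neg_zero, dirDeriv_zero_right] at this
  exact lt_irrefl _ this

end Corner

/-! ### From trajectories to infinitesimal inequalities -/

section Trajectory

variable {f : Seminorm ℝ Plane} {K : Set Mat}

theorem exists_trajectory_of_const {A : Mat} (hA : A ∈ K) (z : Plane) :
    ∃ x : ℝ → Plane, IsTrajectory K x ∧ x 0 = z ∧ HasDerivAt x (A.mulVec z) 0 := by
  let L : Plane →L[ℝ] Plane := LinearMap.toContinuousLinearMap A.mulVecLin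
  let x : ℝ → Plane := fun t => NormedSpace.exp (t • L) z
  have hx : ∀ t, HasDerivAt x (A.mulVec (x t)) t := fun t => by
    have h : HasDerivAt x (L (x t)) t := by
      simpa using (hasDerivAt_exp_smul_const' L t).clm_apply (hasDerivAt_const t z)
    exact h
  have hx0 : x 0 = z := by simp [x]
  have hc : Continuous x := continuous_iff_continuousAt.2 fun t => (hx t).continuousAt
  have hcA : Continuous fun s => A.mulVec (x s) := by fun_prop
  refine ⟨x, ⟨fun _ => A, fun _ _ => measurable_const, fun _ _ => hA, hc.continuousOn,
    fun t _ => ⟨hcA.intervalIntegrable _ _, ?_⟩⟩, hx0, by simpa only [hx0] using hx 0⟩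
  rw [intervalIntegral.integral_eq_sub_of_hasDerivAt (fun s _ => hx s)
    (hcA.intervalIntegrable _ _), add_sub_cancel]

/-- If `f` does not exceed its initial value along a curve, its derivative along the initial
velocity is nonpositive. -/
theorem dirDeriv_nonpos_of_hasDerivAt {x : ℝ → Plane} {v : Plane} (hx : HasDerivAt x v 0)
    (hf : ∀ t, 0 ≤ t → f (x t) ≤ f (x 0)) : dirDeriv f (x 0) v ≤ 0 := by
  have h1 : Tendsto (fun h : ℝ => f (v - h⁻¹ • (x h - x 0))) (𝓝[>] 0) (𝓝 0) := by
    have h2 := (hasDerivAt_iff_tendsto_slope_zero.1 hx).mono_left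
      (nhdsWithin_mono 0 fun t (ht : t ∈ Ioi (0 : ℝ)) => ne_of_gt ht)
    have := ((seminorm_continuous f).tendsto (v - v)).comp (tendsto_const_nhds.sub h2)
    simpa [Function.comp_def] using this
  refine ge_of_tendsto h1 ?_
  filter_upwards [self_mem_nhdsWithin] with h hh
  have hh : 0 < h := hh
  refine (dirDeriv_le_quotient (x 0) v hh).trans ?_
  rw [div_le_iff₀ hh]
  have h3 := map_add_le_add f (x h) (h • (v - h⁻¹ • (x h - x 0)))
  have h4 : x h + h • (v - h⁻¹ • (x h - x 0)) = x 0 + h • v := by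
    rw [smul_sub, smul_smul, mul_inv_cancel₀ hh.ne', one_smul]; abel
  rw [h4, map_smul_eq_mul, Real.norm_of_nonneg hh.le] at h3
  linarith [hf h hh.le]

/-- Constant switching laws give the bound for `K`; since D is sublinear in the velocity, the bound
passes to the hull. -/
theorem IsBarabanovNorm.dirDeriv_nonpos (hf : IsBarabanovNorm K f)
    (hσ : lyapunovExponent K = 0) (z : Plane) {A : Mat} (hA : A ∈ convexHull ℝ K) :
    dirDeriv f z (A.mulVec z) ≤ 0 := by
  refine convexHull_min (fun B hB => ?_) (convex_dirDeriv_mulVec_nonpos z) hA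
  obtain ⟨x, hx, rfl, hd⟩ := exists_trajectory_of_const hB z
  refine dirDeriv_nonpos_of_hasDerivAt hd fun t ht => ?_
  simpa [hσ] using hf.le_of_trajectory x hx t ht

/-- The initial difference quotients of a trajectory approach the set of admissible velocities. -/
theorem IsTrajectory.tendsto_infDist {x : ℝ → Plane} {C : Set Mat} (hx : IsTrajectory C x)
    (hC : IsCompact C) (hconv : Convex ℝ C) :
    Tendsto (fun t : ℝ => Metric.infDist (t⁻¹ • (x t - x 0)) ((fun A : Mat => A.mulVec (x 0)) '' C))
      (𝓝[>] 0) (𝓝 0) := by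
  obtain ⟨A, -, hA, hxc, hint⟩ := hx
  set V := (fun A : Mat => A.mulVec (x 0)) '' C
  have hV : Convex ℝ V := hconv.is_linear_image
    ⟨fun A B => Matrix.add_mulVec A B _, fun c A => Matrix.smul_mulVec c A _⟩
  refine Metric.tendsto_nhds.2 fun ε hε => ?_
  have hclose : ∀ᶠ y in 𝓝 (x 0), ∀ B ∈ C, dist (B.mulVec y) (B.mulVec (x 0)) < ε / 2 := by
    refine hC.eventually_forall_of_forall_eventually fun B _ => ?_
    have : Continuous fun p : Plane × Mat => dist (p.2.mulVec p.1) (p.2.mulVec (x 0)) := by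
      fun_prop
    exact this.continuousAt.eventually_lt_const (by simpa using half_pos hε)
  have hxt : ∀ᶠ s in 𝓝[≥] (0 : ℝ), ∀ B ∈ C, dist (B.mulVec (x s)) (B.mulVec (x 0)) < ε / 2 :=
    (hxc 0 self_mem_Ici).eventually hclose
  obtain ⟨δ, hδ, hδ'⟩ := mem_nhdsGE_iff_exists_Icc_subset.1 hxt
  filter_upwards [Ioc_mem_nhdsGT hδ] with t ht
  obtain ⟨hi, he⟩ := hint t ht.1.le
  -- For small `t` every velocity on `(0, t]` is within `ε / 2` of `V`; the closed thickening of `V`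
  -- is convex, so it contains their average.
  have hmem : (⨍ s in (0 : ℝ)..t, (A s).mulVec (x s)) ∈ Metric.cthickening (ε / 2) V := by
    refine (hV.cthickening _).set_average_mem Metric.isClosed_cthickening ?_ ?_ ?_ ?_
    · simp [uIoc_of_le ht.1.le, ht.1]
    · simp [uIoc_of_le ht.1.le]
    · refine (ae_restrict_iff' measurableSet_uIoc).2 (Eventually.of_forall fun s hs => ?_)
      rw [uIoc_of_le ht.1.le] at hs
      refine Metric.mem_cthickening_of_dist_le _ _ _ _ ⟨A s, hA s hs.1.le, rfl⟩ ?_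
      exact (hδ' ⟨hs.1.le, hs.2.trans ht.2⟩ (A s) (hA s hs.1.le)).le
    · exact intervalIntegrable_iff.1 hi
  rw [interval_average_eq, sub_zero, eq_sub_of_add_eq' he.symm] at hmem
  rw [Real.dist_0_eq_abs, abs_of_nonneg Metric.infDist_nonneg]
  have hne : V.Nonempty := ⟨_, A 0, hA 0 le_rfl, rfl⟩
  rw [Metric.mem_cthickening_iff] at hmem
  have := ENNReal.toReal_mono ENNReal.ofReal_ne_top hmem
  rw [ENNReal.toReal_ofReal (half_pos hε).le] at this
  exact lt_of_le_of_lt this (half_lt_self hε)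

/-- An extremal trajectory need not be differentiable at 0, but its difference quotients accumulate
at an admissible velocity, by compactness. -/
theorem IsBarabanovNorm.exists_dirDeriv_nonneg (hf : IsBarabanovNorm K f)
    (hσ : lyapunovExponent K = 0) (hK : IsCompact K) (z : Plane) :
    ∃ A ∈ convexHull ℝ K, 0 ≤ dirDeriv f z (A.mulVec z) := by
  obtain ⟨x, hx, rfl, hext⟩ := hf.exists_extremal z
  simp only [hσ, zero_mul, Real.exp_zero, one_mul] at hext
  have hC := isCompact_convexHull_of_finiteDimensional hK
  have hlim := hx.tendsto_infDist hC (convex_convexHull ℝ K)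
  set V := (fun A : Mat => A.mulVec (x 0)) '' convexHull ℝ K
  have hVc : IsCompact V := hC.image (by fun_prop)
  have hne : V.Nonempty := by
    obtain ⟨A, -, hA, -⟩ := hx
    exact ⟨_, A 0, hA 0 le_rfl, rfl⟩
  let t : ℕ → ℝ := fun n => 1 / ((n : ℝ) + 1)
  have ht0 : ∀ n, 0 < t n := fun n => Nat.one_div_pos_of_nat
  have ht : Tendsto t atTop (𝓝[>] 0) :=
    tendsto_nhdsWithin_iff.2 ⟨tendsto_one_div_add_atTop_nhds_zero_nat, Eventually.of_forall ht0⟩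
  let v : ℕ → Plane := fun n => (t n)⁻¹ • (x (t n) - x 0)
  have hvx : ∀ n, x 0 + t n • v n = x (t n) := fun n => by
    simp only [v]
    rw [smul_smul, mul_inv_cancel₀ (ht0 n).ne', one_smul, add_sub_cancel]
  choose w hwV hw using fun n => hVc.exists_infDist_eq_dist hne (v n)
  obtain ⟨u, ⟨A, hA, rfl⟩, φ, hφ, hwu⟩ := hVc.tendsto_subseq hwV
  have hvu : Tendsto (v ∘ φ) atTop (𝓝 (A.mulVec (x 0))) := by
    refine hwu.congr_dist ?_
    refine ((hlim.comp ht).comp hφ.tendsto_atTop).congr fun n => ?_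
    rw [dist_comm]
    exact hw (φ n)
  refine ⟨A, hA, dirDeriv_nonneg_iff.2 fun h hh => ?_⟩
  refine ge_of_tendsto (((seminorm_continuous f).tendsto _).comp
    (tendsto_const_nhds.add (hvu.const_smul h))) ?_
  have hth : ∀ᶠ n in atTop, t (φ n) < h :=
    ((ht.mono_right nhdsWithin_le_nhds).comp hφ.tendsto_atTop).eventually_lt_const hh
  filter_upwards [hth] with n hn
  -- At step `t (φ n)` the quotient is 0, because `f` is constant along the trajectory; by
  -- monotonicity it is nonnegative at the longer step `h`.
  have := quotient_mono (f := f) (x 0) (v (φ n)) (ht0 _) hn.le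
  rw [hvx, hext _ (ht0 _).le, sub_self, zero_div, le_div_iff₀ hh, zero_mul, sub_nonneg] at this
  exact this

end Trajectory

/-! ### Sense of rotation of the extremal velocities -/

section Turning

variable {f : Seminorm ℝ Plane} {C : Set Mat}

theorem dir_ne_zero (θ : ℝ) : dir θ ≠ 0 := by
  intro h
  have h0 := congrFun h 0
  have h1 := congrFun h 1
  simp [dir] at h0 h1
  have := Real.sin_sq_add_cos_sq θ
  rw [h0, h1] at this
  norm_num at this

theorem continuous_dir : Continuous dir := by
  unfold dir
  refine continuous_pi fun i => ?_
  fin_cases i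
  · exact Real.continuous_cos
  · exact Real.continuous_sin

theorem cross_dir (α β : ℝ) : cross (dir α) (dir β) = Real.sin (β - α) := by
  simp [cross, dir, Real.sin_sub]; ring

variable (f C) in
/-- Some matrix of `C` moves `z` without decreasing `f` to first order, counterclockwise if `σ` is
positive and clockwise if `σ` is negative. -/
def Turns (σ : ℝ) (z : Plane) : Prop :=
  ∃ A ∈ C, 0 ≤ dirDeriv f z (A.mulVec z) ∧ 0 < σ * cross z (A.mulVec z)

theorem turns_or_turns {z : Plane} (hz : 0 < f z)
    (hle : ∀ A ∈ C, dirDeriv f z (A.mulVec z) ≤ 0)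
    (hge : ∃ A ∈ C, 0 ≤ dirDeriv f z (A.mulVec z)) (hker : ∀ A ∈ C, A.mulVec z ≠ 0) :
    Turns f C 1 z ∨ Turns f C (-1) z := by
  obtain ⟨A, hA, hD⟩ := hge
  rcases lt_trichotomy (cross z (A.mulVec z)) 0 with h | h | h
  · exact Or.inr ⟨A, hA, hD, by linarith⟩
  · exact absurd (eq_zero_of_cross_eq_zero hz h (le_antisymm (hle A hA) hD)) (hker A hA)
  · exact Or.inl ⟨A, hA, hD, by linarith⟩

/-- Limits of extremal velocities with a fixed sense of rotation. -/
theorem exists_tendsto_of_turns {σ : ℝ} {z : Plane} {y : ℕ → Plane} (hC : IsCompact C)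
    (hz : 0 < f z) (hle : ∀ A ∈ C, dirDeriv f z (A.mulVec z) ≤ 0) (hσ : σ ≠ 0)
    (hker : ∀ A ∈ C, A.mulVec z ≠ 0) (hy : Tendsto y atTop (𝓝 z)) (ht : ∀ n, Turns f C σ (y n)) :
    ∃ A ∈ C, 0 ≤ dirDeriv f z (A.mulVec z) ∧ 0 < σ * cross z (A.mulVec z) ∧
      ∃ (φ : ℕ → ℕ) (B : ℕ → Mat), StrictMono φ ∧ Tendsto B atTop (𝓝 A) ∧
        ∀ n, 0 ≤ dirDeriv f (y (φ n)) ((B n).mulVec (y (φ n))) ∧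
          0 < σ * cross (y (φ n)) ((B n).mulVec (y (φ n))) := by
  choose B hB hD hc using ht
  have : FirstCountableTopology Mat := inferInstanceAs (FirstCountableTopology (Fin 2 → Fin 2 → ℝ))
  obtain ⟨A, hA, φ, hφ, hBA⟩ := hC.tendsto_subseq hB
  have hyφ := hy.comp hφ.tendsto_atTop
  have hv : Tendsto (fun n => (B (φ n)).mulVec (y (φ n))) atTop (𝓝 (A.mulVec z)) := by
    have : Continuous fun p : Mat × Plane => p.1.mulVec p.2 := by fun_prop
    exact (this.tendsto (A, z)).comp (hBA.prodMk_nhds hyφ)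
  have hDA : 0 ≤ dirDeriv f z (A.mulVec z) :=
    dirDeriv_nonneg_of_tendsto hyφ hv (Eventually.of_forall fun n => hD (φ n))
  have hcA : 0 ≤ σ * cross z (A.mulVec z) := by
    have := ((continuous_cross.tendsto (z, A.mulVec z)).comp
      (hyφ.prodMk_nhds hv)).const_mul σ
    exact ge_of_tendsto' this fun n => (hc (φ n)).le
  -- The strict sign survives in the limit: otherwise the limit velocity would be radial and
  -- stationary, hence 0, against `hker`.
  refine ⟨A, hA, hDA, hcA.lt_of_ne' (mul_ne_zero hσ fun h => ?_), φ, B ∘ φ, hφ, hBA,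
    fun n => ⟨hD _, hc _⟩⟩
  exact hker A hA (eq_zero_of_cross_eq_zero hz h (le_antisymm (hle A hA) hDA))

theorem turns_of_tendsto {σ : ℝ} {z : Plane} {y : ℕ → Plane} (hC : IsCompact C)
    (hz : 0 < f z) (hle : ∀ A ∈ C, dirDeriv f z (A.mulVec z) ≤ 0) (hσ : σ ≠ 0)
    (hker : ∀ A ∈ C, A.mulVec z ≠ 0) (hy : Tendsto y atTop (𝓝 z))
    (ht : ∀ n, Turns f C σ (y n)) : Turns f C σ z := by
  obtain ⟨A, hA, hD, hc, -⟩ := exists_tendsto_of_turns hC hz hle hσ hker hy ht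
  exact ⟨A, hA, hD, hc⟩

/-- Cramer's rule for the point where the line through `y` along `v` meets the line spanned by `z`.
-/
theorem add_smul_eq_smul_of_cross {y z v : Plane} (h : cross z v ≠ 0) :
    y + (-(cross z y) / cross z v) • v = (cross y v / cross z v) • z := by
  ext i
  fin_cases i <;> simp <;> field_simp <;> simp only [cross] <;> ring

/-- Near a corner, the extremal velocities do not point towards the corner. -/
theorem HasCorner.not_turns_of_tendsto {σ : ℝ} {z : Plane} {y : ℕ → Plane} (h : HasCorner f z)
    (hC : IsCompact C) (hz : 0 < f z) (hle : ∀ A ∈ C, dirDeriv f z (A.mulVec z) ≤ 0)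
    (hσ : σ ≠ 0) (hker : ∀ A ∈ C, A.mulVec z ≠ 0) (hy : Tendsto y atTop (𝓝 z))
    (hside : ∀ᶠ n in atTop, σ * cross z (y n) < 0) : ¬ ∀ n, Turns f C σ (y n) := by
  intro ht
  obtain ⟨A, hA, -, hc, φ, B, hφ, hBA, hB⟩ := exists_tendsto_of_turns hC hz hle hσ hker hy ht
  have hyφ := hy.comp hφ.tendsto_atTop
  have hv : Tendsto (fun n => (B n).mulVec (y (φ n))) atTop (𝓝 (A.mulVec z)) := by
    have : Continuous fun p : Mat × Plane => p.1.mulVec p.2 := by fun_prop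
    exact (this.tendsto (A, z)).comp (hBA.prodMk_nhds hyφ)
  have hcv : ∀ᶠ n in atTop, 0 < σ * cross z ((B n).mulVec (y (φ n))) :=
    (((continuous_cross.tendsto (z, A.mulVec z)).comp
      (tendsto_const_nhds.prodMk_nhds hv)).const_mul σ).eventually_const_lt hc
  -- From the side given by `hside`, the ray from `y (φ n)` along its velocity hits the open ray of
  -- `z`: both Cramer coefficients are positive.
  have hneg : dirDeriv f z (-A.mulVec z) ≤ 0 := by
    refine dirDeriv_nonpos_of_tendsto hv.neg ?_
    filter_upwards [hcv, hφ.tendsto_atTop.eventually hside] with n h1 h2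
    obtain ⟨h3, h4⟩ := hB n
    have hne : cross z ((B n).mulVec (y (φ n))) ≠ 0 := fun h => by
      rw [h, mul_zero] at h1; exact h1.false
    refine dirDeriv_neg_nonpos_of_add_smul_eq ?_ ?_ (add_smul_eq_smul_of_cross hne) h3
    · rw [← mul_div_mul_left _ _ hσ]
      exact div_pos (by linarith) h1
    · rw [← mul_div_mul_left _ _ hσ]
      exact div_pos h4 h1
  have hcne : cross z (A.mulVec z) ≠ 0 := fun h => by
    rw [h, mul_zero] at hc; exact hc.false
  exact (h _ hcne (hle A hA)).not_ge hneg

/-- Where `f` is smooth, all extremal velocities of a convex control set that does not annihilate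
the point have the same sense of rotation. -/
theorem not_turns_and_turns {z : Plane} (h : ¬ HasCorner f z) (hz : 0 < f z)
    (hconv : Convex ℝ C) (hle : ∀ A ∈ C, dirDeriv f z (A.mulVec z) ≤ 0)
    (hker : ∀ A ∈ C, A.mulVec z ≠ 0) : ¬ (Turns f C 1 z ∧ Turns f C (-1) z) := by
  rintro ⟨⟨A, hA, hDA, hcA⟩, B, hB, hDB, hcB⟩
  simp only [HasCorner, not_forall, not_lt] at h
  obtain ⟨w, hw, h1, h2⟩ := h
  -- an extremal velocity is tangent to the line along which `f` is stationary
  have tangent : ∀ v, dirDeriv f z v = 0 → ∃ c : ℝ, v = c • w := by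
    intro v hv
    have hw' : ∀ c : ℝ, dirDeriv f z (c • w) ≤ 0 := fun c => by
      rcases le_total 0 c with hc | hc
      · exact dirDeriv_smul_nonpos hc h1
      · rw [← neg_smul_neg]; exact dirDeriv_smul_nonpos (neg_nonneg.2 hc) h2
    have hv2 : v = (cross v w / cross z w) • z + (cross z v / cross z w) • w := by
      rw [← add_smul_eq_smul_of_cross (y := v) hw, neg_div, neg_smul, neg_add_cancel_right]
    set a := cross v w / cross z w
    set b := cross z v / cross z w
    have ha1 : 0 ≤ a * f z := by
      have := dirDeriv_add_le (f := f) z (a • z) (b • w)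
      rw [← hv2, hv, dirDeriv_smul_self] at this
      linarith [hw' b]
    have ha2 : a * f z ≤ 0 := by
      have := dirDeriv_add_le (f := f) z v (-b • w)
      rw [hv, hv2, neg_smul, add_neg_cancel_right, dirDeriv_smul_self, ← neg_smul] at this
      linarith [hw' (-b)]
    have ha : a = 0 := (mul_eq_zero.1 (le_antisymm ha2 ha1)).resolve_right hz.ne'
    exact ⟨b, by rw [hv2, ha, zero_smul, zero_add]⟩
  obtain ⟨α, hα⟩ := tangent _ (le_antisymm (hle A hA) hDA)
  obtain ⟨β, hβ⟩ := tangent _ (le_antisymm (hle B hB) hDB)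
  set p := cross z (A.mulVec z) with hp
  set q := -cross z (B.mulVec z) with hq
  have hp0 : 0 < p := by linarith
  have hq0 : 0 < q := by linarith
  have hpα : p = α * cross z w := by
    rw [hp, hα]; simpa using cross_add_smul_right z w 0 α
  have hqβ : q = -(β * cross z w) := by
    rw [hq, hβ]; simpa using cross_add_smul_right z w 0 β
  -- The weights are proportional to `q` for `A` and `p` for `B`; since `q α + p β = 0`, the two
  -- velocities cancel.
  refine hker _ (hconv hA hB (div_nonneg hq0.le (add_pos hq0 hp0).le)
    (div_nonneg hp0.le (add_pos hq0 hp0).le)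
    (by rw [← add_div, div_self (add_pos hq0 hp0).ne'])) ?_
  rw [Matrix.add_mulVec, Matrix.smul_mulVec, Matrix.smul_mulVec, hα, hβ, smul_smul, smul_smul,
    ← add_smul, div_mul_eq_mul_div, div_mul_eq_mul_div, ← add_div, hpα, hqβ]
  ring_nf
  simp

/-- Between two corners of `f` there is a direction that is annihilated by a control. -/
theorem exists_mulVec_dir_eq_zero (hC : IsCompact C) (hconv : Convex ℝ C)
    (hf : ∀ z, z ≠ 0 → 0 < f z) (hle : ∀ z, ∀ A ∈ C, dirDeriv f z (A.mulVec z) ≤ 0)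
    (hge : ∀ z, ∃ A ∈ C, 0 ≤ dirDeriv f z (A.mulVec z)) {a t : ℝ} (ht : 0 < t)
    (h₀ : HasCorner f (dir a)) (h₁ : HasCorner f (dir (a + t))) :
    ∃ A ∈ C, ∃ s ∈ Icc 0 t, A.mulVec (dir (a + s)) = 0 := by
  by_contra! hker
  let γ : ℝ → Plane := fun s => dir (a + s)
  have hγ : Continuous γ := continuous_dir.comp (by fun_prop)
  have hfγ : ∀ s, 0 < f (γ s) := fun s => hf _ (dir_ne_zero _)
  have hkerγ : ∀ s ∈ Icc 0 t, ∀ A ∈ C, A.mulVec (γ s) ≠ 0 := fun s hs A hA => hker A hA s hs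
  have hcross : ∀ r s, cross (γ r) (γ s) = Real.sin (s - r) := fun r s => by
    simp only [γ, cross_dir, add_sub_add_left_eq_sub]
  have cover : ∀ s ∈ Icc 0 t, ¬ Turns f C (-1) (γ s) → Turns f C 1 (γ s) := fun s hs h =>
    (turns_or_turns (hfγ s) (hle _) (hge _) (hkerγ s hs)).resolve_right h
  have limit : ∀ σ : ℝ, σ ≠ 0 → ∀ s ∈ Icc 0 t, ∀ u : ℕ → ℝ, Tendsto u atTop (𝓝 s) →
      (∀ n, Turns f C σ (γ (u n))) → Turns f C σ (γ s) := fun σ hσ s hs u hu h =>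
    turns_of_tendsto hC (hfγ s) (hle _) hσ (hkerγ s hs) ((hγ.tendsto s).comp hu) h
  have right : ∀ s ∈ Icc 0 t, HasCorner f (γ s) → ∀ᶠ r in 𝓝[>] s, ¬ Turns f C (-1) (γ r) := by
    intro s hs hcor
    by_contra hcon
    obtain ⟨u, hu, hT⟩ := frequently_iff_seq_forall.1 (not_eventually.1 hcon)
    simp only [not_not] at hT
    refine hcor.not_turns_of_tendsto hC (hfγ s) (hle _) (by norm_num) (hkerγ s hs)
      ((hγ.tendsto s).comp (hu.mono_right nhdsWithin_le_nhds)) ?_ hT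
    filter_upwards [hu.eventually (Ioo_mem_nhdsGT (by linarith [Real.pi_pos] : s < s + Real.pi))]
      with n hn
    have := Real.sin_pos_of_pos_of_lt_pi (x := u n - s) (by linarith [hn.1]) (by linarith [hn.2])
    simp only [Function.comp_apply, hcross]
    linarith
  have left : ∀ s ∈ Icc 0 t, HasCorner f (γ s) → ∀ᶠ r in 𝓝[<] s, ¬ Turns f C 1 (γ r) := by
    intro s hs hcor
    by_contra hcon
    obtain ⟨u, hu, hT⟩ := frequently_iff_seq_forall.1 (not_eventually.1 hcon)
    simp only [not_not] at hT
    refine hcor.not_turns_of_tendsto hC (hfγ s) (hle _) one_ne_zero (hkerγ s hs)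
      ((hγ.tendsto s).comp (hu.mono_right nhdsWithin_le_nhds)) ?_ hT
    filter_upwards [hu.eventually (Ioo_mem_nhdsLT (by linarith [Real.pi_pos] : s - Real.pi < s))]
      with n hn
    have := Real.sin_neg_of_neg_of_neg_pi_lt (x := u n - s) (by linarith [hn.2])
      (by linarith [hn.1])
    simp only [Function.comp_apply, hcross]
    linarith
  obtain ⟨δ, hδ, hδT⟩ := mem_nhdsGT_iff_exists_Ioo_subset.1
    (right 0 ⟨le_rfl, ht.le⟩ (by simpa only [γ, add_zero] using h₀))
  have hδ0 : (0 : ℝ) < min δ t := lt_min hδ ht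
  -- No point with parameter in `(0, δ)` turns clockwise. Starting the search at `d < δ` therefore
  -- misses nothing, and keeps the first clockwise point away from the initial corner.
  set d := min δ t / 2 with hd
  have hd0 : 0 < d := half_pos hδ0
  have hdδ : d < δ := (half_lt_self hδ0).trans_le (min_le_left _ _)
  have hdt : d < t := (half_lt_self hδ0).trans_le (min_le_right _ _)
  let R : Set ℝ := {s | s ∈ Icc d t ∧ Turns f C (-1) (γ s)}
  have hR : IsClosed R := by
    refine IsSeqClosed.isClosed fun u s hu hus => ?_
    have hs : s ∈ Icc d t := isClosed_Icc.mem_of_tendsto hus (Eventually.of_forall fun n => (hu n).1)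
    exact ⟨hs, limit _ (by norm_num) s ⟨hd0.le.trans hs.1, hs.2⟩ u hus fun n => (hu n).2⟩
  have hRc : IsCompact R := isCompact_Icc.of_isClosed_subset hR fun s hs => hs.1
  have hRne : R.Nonempty := by
    -- Just before the final corner, counterclockwise rotation would point at it, so the rotation
    -- there is clockwise.
    obtain ⟨s, hs1, hs2⟩ := ((left t ⟨ht.le, le_rfl⟩ h₁).and (Ioo_mem_nhdsLT hdt)).exists
    refine ⟨s, ⟨hs2.1.le, hs2.2.le⟩, ?_⟩
    by_contra hcon
    exact hs1 (cover s ⟨hd0.le.trans hs2.1.le, hs2.2.le⟩ hcon)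
  obtain ⟨z, ⟨hz, hzR⟩, hmin⟩ := hRc.exists_isLeast hRne
  have hz0 : 0 < z := hd0.trans_le hz.1
  have hzI : z ∈ Icc 0 t := ⟨hz0.le, hz.2⟩
  have hL : ∀ᶠ s in 𝓝[<] z, Turns f C 1 (γ s) := by
    filter_upwards [Ioo_mem_nhdsLT hz0] with s hs
    have hst : s ≤ t := hs.2.le.trans hz.2
    refine cover s ⟨hs.1.le, hst⟩ fun hT => ?_
    rcases lt_or_ge s d with h | h
    · exact hδT ⟨hs.1, h.trans hdδ⟩ hT
    · exact (hmin ⟨⟨h, hst⟩, hT⟩).not_gt hs.2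
  -- Points just before `z` rotate towards it, which a corner forbids; at a smooth point, both
  -- senses would occur at `z` in the limit.
  by_cases hcor : HasCorner f (γ z)
  · obtain ⟨s, h1, h2⟩ := (hL.and (left z hzI hcor)).exists
    exact h2 h1
  · obtain ⟨u, hu, hT⟩ := frequently_iff_seq_forall.1 hL.frequently
    exact not_turns_and_turns hcor (hfγ z) hconv (hle _) (hkerγ z hzI)
      ⟨limit 1 one_ne_zero z hzI u (hu.mono_right nhdsWithin_le_nhds) hT, hzR⟩

theorem exists_eq_smul_dir {x : Plane} (hx : x ≠ 0) :
    ∃ r θ : ℝ, 0 < r ∧ x = r • dir θ := by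
  let w : ℂ := ⟨x 0, x 1⟩
  have hw : w ≠ 0 := fun h => hx (funext fun i => by
    fin_cases i
    · exact congrArg Complex.re h
    · exact congrArg Complex.im h)
  refine ⟨‖w‖, w.arg, norm_pos_iff.2 hw, funext fun i => ?_⟩
  fin_cases i
  · exact (Complex.norm_mul_cos_arg w).symm
  · exact (Complex.norm_mul_sin_arg w).symm

end Turning

/-! ### Assembling the theorem -/

section Main

variable {f : Seminorm ℝ Plane} {K : Set Mat}

theorem IsBarabanovNorm.pos (hf : IsBarabanovNorm K f) {z : Plane} (hz : z ≠ 0) : 0 < f z :=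
  (apply_nonneg f z).lt_of_ne' fun h => hz (hf.eq_zero_of_map_eq_zero z h)

theorem isDegenerate_of_mulVec_eq_zero {A : Mat} {y : Plane} (hA : A ≠ 0) (hy : y ≠ 0)
    (h : A.mulVec y = 0) : IsDegenerate A :=
  ⟨Matrix.exists_mulVec_eq_zero_iff.1 ⟨y, hy, h⟩, hA⟩

theorem IsBarabanovNorm.exists_isDegenerate (hf : IsBarabanovNorm K f) (hK : IsCompact K)
    (hzero : (0 : Mat) ∉ K) (hσ : lyapunovExponent K = 0) {a t : ℝ} (ht : 0 < t)
    (h₀ : HasCorner f (dir a)) (h₁ : HasCorner f (dir (a + t))) :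
    ∃ A ∈ convexHull ℝ K, IsDegenerate A ∧ ∃ s ∈ Icc 0 t, A.mulVec (dir (a + s)) = 0 := by
  by_cases h0 : (0 : Mat) ∈ convexHull ℝ K
  · obtain ⟨A, hA, hAz⟩ := h₀.exists_mulVec_eq_zero (hf.pos (dir_ne_zero a))
      (fun A hA => hf.dirDeriv_nonpos hσ _ (subset_convexHull ℝ K hA)) h0
    exact ⟨A, subset_convexHull ℝ K hA,
      isDegenerate_of_mulVec_eq_zero (fun h => hzero (h ▸ hA)) (dir_ne_zero a) hAz,
      0, ⟨le_rfl, ht.le⟩, by rwa [add_zero]⟩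
  · obtain ⟨A, hA, s, hs, hAs⟩ := exists_mulVec_dir_eq_zero
      (isCompact_convexHull_of_finiteDimensional hK) (convex_convexHull ℝ K)
      (fun _ => hf.pos) (fun z _ hA => hf.dirDeriv_nonpos hσ z hA)
      (hf.exists_dirDeriv_nonneg hσ hK) ht h₀ h₁
    exact ⟨A, hA, isDegenerate_of_mulVec_eq_zero (fun h => h0 (h ▸ hA)) (dir_ne_zero _) hAs,
      s, hs, hAs⟩

end Main

end PlanarSwitching

theorem propositionp70 (K : Set PlanarSwitching.Mat) (hK : IsCompact K)
    (hirr : PlanarSwitching.IsIrreducible K) (hzero : (0 : PlanarSwitching.Mat) ∉ K)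
    (hσ : PlanarSwitching.lyapunovExponent K = 0)
    (f : Seminorm ℝ PlanarSwitching.Plane) (hf : PlanarSwitching.IsBarabanovNorm K f) :
    (∀ x₁ x₂ : PlanarSwitching.Plane, x₁ ≠ x₂ →
      PlanarSwitching.IsCornerPoint (PlanarSwitching.unitSphere f) x₁ →
      PlanarSwitching.IsCornerPoint (PlanarSwitching.unitSphere f) x₂ →
      ∃ A ∈ convexHull ℝ K, PlanarSwitching.IsDegenerate A ∧
        ∃ y ∈ PlanarSwitching.arc (PlanarSwitching.unitSphere f) x₁ x₂, A.mulVec y = 0) ∧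
    ((∃ x : PlanarSwitching.Plane, x ≠ 0 ∧ ¬ DifferentiableAt ℝ (fun z => f z) x) →
      ∃ A ∈ convexHull ℝ K, PlanarSwitching.IsDegenerate A) := by
  open PlanarSwitching in
  constructor
  · intro x₁ x₂ hne hx₁ hx₂
    have hfx₁ : f x₁ = 1 := hx₁.1
    have hfx₂ : f x₂ = 1 := hx₂.1
    obtain ⟨r₁, a, hr₁, rfl⟩ := exists_eq_smul_dir (x := x₁) (by rintro rfl; simp at hfx₁)
    obtain ⟨r₂, b, hr₂, rfl⟩ := exists_eq_smul_dir (x := x₂) (by rintro rfl; simp at hfx₂)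
    obtain ⟨t, ⟨ht0, ht⟩, hb⟩ : ∃ t ∈ Set.Ico 0 (2 * Real.pi), dir b = dir (a + t) := by
      -- The angle `b - a` is reduced modulo `2π`, as `arc` requires `t < 2π`.
      refine ⟨toIcoMod Real.two_pi_pos 0 (b - a), toIcoMod_mem_Ico' Real.two_pi_pos _, ?_⟩
      have h1 : a + toIcoMod Real.two_pi_pos 0 (b - a) =
          b - toIcoDiv Real.two_pi_pos 0 (b - a) * (2 * Real.pi) := by
        rw [← self_sub_toIcoDiv_mul]; ring
      rw [h1, dir, dir, Real.cos_sub_int_mul_two_pi, Real.sin_sub_int_mul_two_pi]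
    rw [hb] at hne hx₂ hfx₂ ⊢
    -- With `t = 0` both points lie on one ray, and `f = 1` makes them equal.
    have htpos : 0 < t := by
      refine ht0.lt_of_ne fun h => hne ?_
      rw [← h, add_zero] at hfx₂ ⊢
      rw [map_smul_eq_mul, Real.norm_of_nonneg hr₁.le] at hfx₁
      rw [map_smul_eq_mul, Real.norm_of_nonneg hr₂.le] at hfx₂
      rw [mul_right_cancel₀ (hf.pos (dir_ne_zero a)).ne' (hfx₁.trans hfx₂.symm)]
    obtain ⟨A, hA, hdeg, s, hs, hAs⟩ := hf.exists_isDegenerate hK hzero hσ htpos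
      (hx₁.hasCorner.of_smul hr₁) (hx₂.hasCorner.of_smul hr₂)
    have hpos := inv_pos.2 (hf.pos (dir_ne_zero (a + s)))
    refine ⟨A, hA, hdeg, (f (dir (a + s)))⁻¹ • dir (a + s), ⟨?_, a, s, t, hs.1, hs.2, ht,
      SameRay.sameRay_pos_smul_right _ hr₁, SameRay.sameRay_pos_smul_right _ hpos,
      SameRay.sameRay_pos_smul_right _ hr₂⟩, by rw [Matrix.mulVec_smul, hAs, smul_zero]⟩
    change f _ = 1
    rw [map_smul_eq_mul, Real.norm_of_nonneg hpos.le, inv_mul_cancel₀ (inv_pos.1 hpos).ne']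
  · rintro ⟨x, hx, hd⟩
    obtain ⟨r, a, hr, rfl⟩ := exists_eq_smul_dir hx
    have hcor := (hasCorner_of_not_differentiableAt hd).of_smul hr
    -- The antipode is a corner by symmetry of `f`, so an arc of angle `π` joins two corners.
    have hneg : dir (a + Real.pi) = -dir a := by
      ext i
      fin_cases i <;> simp [dir]
    obtain ⟨A, hA, hdeg, -⟩ := hf.exists_isDegenerate hK hzero hσ Real.pi_pos hcor
      (by rw [hneg]; exact hcor.neg)
    exact ⟨A, hA, hdeg⟩
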